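/- Consider a multi-hop network given by a finite connected directed graph with node set $\mathcal N$ and link set $\mathcal L$, in which link $l$ goes from node $\mathrm{Tx}(l)$ to node $\mathrm{Rx}(l)\ne \mathrm{Tx}(l)$ and has capacity $C_l$. The network carries $F$ sessions; session $f$ has source $\mathrm{Src}(f)$ and destination $\mathrm{Dst}(f)\neq \mathrm{Src}(f)$, and a utility function $U_f$ on $(0,\infty)$ that is strictly concave, increasing and twice continuously differentiable. Let $t>0$, and consider the barrier objective $$f(y) = -t\sum_{f} U_f(s_f) - \sum_{l}\log\Big(C_l-\sum_f x_l^{(f)}\Big) - \sum_f \log s_f - \sum_{l,f}\log x_l^{(f)}$$ of the vector $y=\big((s_f)_f,(x_l^{(f)})_{l,f}\big)$. Let $y$ be any point with $s_f>0$, $x_l^{(f)}>0$ and $\sum_{f} x_l^{(f)}<C_l$ for all $f$ and $l$, and let $H=\nabla^2 f(y)$. Let $M$ be the matrix whose rows are indexed by the pairs $(n,f)$ with $n\in\mathcal N$, $n\neq \mathrm{Dst}(f)$, such that $$(My)_{(n,f)} = b^{(f)}_n s_f-\sum_{l}A_{nl}x_l^{(f)},$$ where $A$ is the node-arc incidence matrix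 ($A_{nl}=1$ if $n=\mathrm{Tx}(l)$, $-1$ if $n=\mathrm{Rx}(l)$, $0$ otherwise) and $b^{(f)}_n=1$ if $n=\mathrm{Src}(f)$, $b^{(f)}_n=0$ for the other nodes $n\ne\mathrm{Dst}(f)$. Let $P=MH^{-1}M^T$, let $\Lambda$ be the diagonal matrix with the same main diagonal as $P$, let $\Omega=P-\Lambda$, and let $\overline\Omega$ be the diagonal matrix with $\overline\Omega_{ii}=\sum_j|\Omega_{ij}|$. For $\alpha>\frac12$ consider the matrix splitting $P=(\Lambda+\alpha\overline\Omega)-(\alpha\overline\Omega-\Omega)$ and the spectral radius $$\rho_\alpha=\rho\big((\Lambda+\alpha\overline\Omega)^{-1}(\alpha\overline\Omega-\Omega)\big)$$ of its iteration matrix. If $\frac12<\alpha_1\le\alpha_2$, then the matrices $H$, $\Lambda+\alpha_1\overline\Omega$ and $\Lambda+\alpha_2\overline\Omega$ are nonsingular (so that all of the above is well defined), and $\rho_{\alpha_1}\le\rho_{\alpha_2}$. -/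

import Mathlib

/-- A connected communication network carrying several sessions. Links are indexed by `L`
(parallel links are allowed), `tx l` and `rx l` are the transmitting and receiving nodes of
link `l`, `cap l` is its capacity, and `src f`, `dst f` are the source and destination of
session `f`. Connectedness is that of the underlying undirected graph. -/
structure FlowNetwork (V L S : Type*) where
  tx : L → V
  rx : L → V
  src : S → V
  dst : S → V
  cap : L → ℝ
  tx_ne_rx : ∀ l, tx l ≠ rx l
  src_ne_dst : ∀ f, src f ≠ dst f
  connected : (SimpleGraph.fromRel (fun u v : V => ∃ l, tx l = u ∧ rx l = v)).Connected

/-- Index set of the primal vector: one source rate `s_f` for each session `f`, and one flow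
`x_l^{(f)}` for each link `l` and session `f`. -/
abbrev PrimalIdx (L S : Type*) := S ⊕ (L × S)

/-- The Hessian matrix of `g` at `y`: its entries are the second partial derivatives. -/
noncomputable def hessianMatrix {ι : Type*} [DecidableEq ι] (g : (ι → ℝ) → ℝ) (y : ι → ℝ) :
    Matrix ι ι ℝ :=
  Matrix.of fun i j =>
    lineDeriv ℝ (fun z => lineDeriv ℝ g z (Pi.single j 1)) y (Pi.single i 1)

namespace FlowNetwork

variable {V L S : Type*} (N : FlowNetwork V L S)

/-- The node-arc incidence matrix. -/
def incidence [DecidableEq V] : Matrix V L ℝ :=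
  Matrix.of fun n l => if n = N.tx l then 1 else if n = N.rx l then -1 else 0

/-- The source-destination vector of session `f`. -/
def srcDstVec [DecidableEq V] (f : S) (n : V) : ℝ :=
  if n = N.src f then 1 else if n = N.dst f then -1 else 0

/-- Index set of the dual vector: pairs of a node `n` and a session `f` with `n ≠ dst f`, since
for each session the flow balance at its destination is redundant and deleted. -/
abbrev DualIdx := {p : V × S // p.1 ≠ N.dst p.2}

/-- The coefficient matrix of the flow balance constraints: the block of session `f` is
`b^{(f)}` in the column of `s_f` and minus the `l`-th incidence column in the column of
`x_l^{(f)}`, with the row of `dst f` deleted; different sessions do not interact. -/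
def constraintMatrix [DecidableEq V] [DecidableEq S] :
    Matrix N.DualIdx (PrimalIdx L S) ℝ :=
  Matrix.of fun r c =>
    match c with
    | Sum.inl f => if r.1.2 = f then N.srcDstVec f r.1.1 else 0
    | Sum.inr (l, f) => if r.1.2 = f then -N.incidence r.1.1 l else 0

/-- The unused capacity of link `l`. -/
def slack [Fintype S] (y : PrimalIdx L S → ℝ) (l : L) : ℝ :=
  N.cap l - ∑ f, y (Sum.inr (l, f))

/-- The objective function with logarithmic barriers. -/
noncomputable def barrierObjective [Fintype L] [Fintype S] (U : S → ℝ → ℝ) (t : ℝ)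
    (y : PrimalIdx L S → ℝ) : ℝ :=
  -t * ∑ f, U f (y (Sum.inl f)) - ∑ l, Real.log (N.slack y l)
    - ∑ f, Real.log (y (Sum.inl f)) - ∑ l, ∑ f, Real.log (y (Sum.inr (l, f)))

/-- `y` lies in the domain of the barrier functions: all rates, all flows and all unused
capacities are positive. -/
def IsInterior [Fintype S] (y : PrimalIdx L S → ℝ) : Prop :=
  (∀ f, 0 < y (Sum.inl f)) ∧ (∀ l f, 0 < y (Sum.inr (l, f))) ∧ ∀ l, 0 < N.slack y l

/-- The Hessian of the barrier objective at `y`. -/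
noncomputable def hessian [Fintype L] [Fintype S] [DecidableEq L] [DecidableEq S]
    (U : S → ℝ → ℝ) (t : ℝ) (y : PrimalIdx L S → ℝ) :
    Matrix (PrimalIdx L S) (PrimalIdx L S) ℝ :=
  hessianMatrix (N.barrierObjective U t) y

/-- The coefficient matrix `M H⁻¹ Mᵀ` of the linear system for the dual variables. -/
noncomputable def dualMatrix [Fintype L] [Fintype S]
    [DecidableEq V] [DecidableEq L] [DecidableEq S]
    (U : S → ℝ → ℝ) (t : ℝ) (y : PrimalIdx L S → ℝ) : Matrix N.DualIdx N.DualIdx ℝ :=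
  N.constraintMatrix * (N.hessian U t y)⁻¹ * N.constraintMatrix.transpose

end FlowNetwork

namespace MatrixSplitting

variable {ι : Type*} [Fintype ι] [DecidableEq ι]

/-- `P = P₁ - P₂` is a splitting of `P`: the first component is nonsingular. -/
def IsSplitting (P P₁ P₂ : Matrix ι ι ℝ) : Prop :=
  IsUnit P₁ ∧ P = P₁ - P₂

/-- The spectral radius of the splitting `P₁ - P₂`, that is, the largest modulus of a complex
eigenvalue of the iteration matrix `P₁⁻¹ P₂`. -/
noncomputable def splittingRadius (P₁ P₂ : Matrix ι ι ℝ) : ENNReal :=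
  spectralRadius ℂ ((P₁⁻¹ * P₂).map Complex.ofReal)

/-- The diagonal matrix `Λ` with the same main diagonal as `P`. -/
def diagPart (P : Matrix ι ι ℝ) : Matrix ι ι ℝ := Matrix.diagonal P.diag

/-- The off-diagonal part `Ω = P - Λ`. -/
def offDiagPart (P : Matrix ι ι ℝ) : Matrix ι ι ℝ := P - diagPart P

/-- The diagonal matrix of the absolute row sums of `Ω`. -/
def absRowSum (P : Matrix ι ι ℝ) : Matrix ι ι ℝ :=
  Matrix.diagonal fun i => ∑ j, |offDiagPart P i j|

/-- First component of the splitting with parameter `α`. -/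
def first (P : Matrix ι ι ℝ) (α : ℝ) : Matrix ι ι ℝ := diagPart P + α • absRowSum P

/-- Second component of the splitting with parameter `α`. -/
def second (P : Matrix ι ι ℝ) (α : ℝ) : Matrix ι ι ℝ := α • absRowSum P - offDiagPart P

end MatrixSplitting

/-! Only two facts about `P` matter: it is positive semidefinite and its diagonal is positive. They
hold because `H` is positive definite and, by connectedness, `M` has no zero row.

Since `Λ + αΩ̄` is a positive diagonal matrix and `αΩ̄ - Ω` is symmetric, `ρ_α` is the least `r ≥ 0`
with `|xᵀ(αΩ̄ - Ω)x| ≤ r xᵀ(Λ + αΩ̄)x` for all real `x`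
(`exists_splittingRadius_eq_and_abs_dotProduct_le`, `splittingRadius_le_of_abs_dotProduct_le`). So
it suffices that `r = ρ_{α₂}` is admissible for `α₁` (`splittingRadius_mono`).

Put `E = xᵀΛx`, `Q = xᵀΩ̄x`, `W = xᵀΩx`; the claim is `|α₁Q - W| ≤ r(E + α₁Q)`. Above: if `r ≤ 1`,
passing from `α₂` to `α₁` lowers the left side at least as much as the right; if `r ≥ 1`, `E + W ≥
0` is enough. Below: `W ≤ Q` and `α₁ ≥ 1/2` give `W - α₁Q ≤ α₁Q`, and `α₁Q ≤ r(E + α₁Q)` comes from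
testing the `α₂` bound on unit vectors. -/

namespace MatrixSplitting

/-- The absolute row sums of a symmetric matrix dominate it as a quadratic form. -/
theorem dotProduct_mulVec_le_sum_abs {ι : Type*} [Fintype ι] {A : Matrix ι ι ℝ} (hA : A.IsSymm) (x : ι → ℝ) :
    x ⬝ᵥ A.mulVec x ≤ ∑ i, (∑ j, |A i j|) * x i ^ 2 := by
  have h1 : x ⬝ᵥ A.mulVec x ≤ ∑ i, ∑ j, |A i j| * ((x i ^ 2 + x j ^ 2) / 2) := by
    simp only [dotProduct, Matrix.mulVec, Finset.mul_sum]
    refine Finset.sum_le_sum fun i _ => Finset.sum_le_sum fun j _ => ?_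
    calc x i * (A i j * x j) ≤ |x i * (A i j * x j)| := le_abs_self _
      _ = |A i j| * (|x i| * |x j|) := by rw [abs_mul, abs_mul]; ring
      _ ≤ _ := by
        gcongr
        nlinarith [sq_nonneg (|x i| - |x j|), sq_abs (x i), sq_abs (x j)]
  -- By symmetry of `A`, the two halves of the AM-GM bound have the same sum.
  have h2 : ∑ i, ∑ j, |A i j| * x j ^ 2 = ∑ i, ∑ j, |A i j| * x i ^ 2 := by
    rw [Finset.sum_comm]
    refine Finset.sum_congr rfl fun i _ => Finset.sum_congr rfl fun j _ => ?_
    rw [hA.apply i j]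
  refine h1.trans_eq ?_
  simp only [Finset.sum_mul, mul_div_assoc', mul_add, add_div, Finset.sum_add_distrib,
    ← Finset.sum_div, h2]
  ring

theorem offDiagPart_isSymm {ι : Type*} [DecidableEq ι] {P : Matrix ι ι ℝ} (hP : P.IsSymm) : (offDiagPart P).IsSymm := by
  simp [Matrix.IsSymm, offDiagPart, diagPart, hP.eq]

/-! ### Spectral radius of a splitting through quadratic forms -/

variable {ι : Type*} [Fintype ι] [DecidableEq ι]

open scoped Matrix.Norms.L2Operator in
/-- The quadratic form of a Hermitian matrix is bounded by its spectral radius. -/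
theorem exists_spectralRadius_eq_and_abs_dotProduct_le {S : Matrix ι ι ℝ} (hS : S.IsSymm) :
    ∃ r : NNReal, spectralRadius ℂ (S.map Complex.ofReal) = r ∧
      ∀ x : ι → ℝ, |x ⬝ᵥ S.mulVec x| ≤ r * (x ⬝ᵥ x) := by
  have hsa : IsSelfAdjoint (S.map Complex.ofReal) := by
    rw [IsSelfAdjoint, Matrix.star_eq_conjTranspose]
    ext i j
    simp [hS.apply i j]
  -- For a self-adjoint matrix the spectral radius is the operator norm, so Cauchy-Schwarz gives the
  -- bound.
  refine ⟨‖S.map Complex.ofReal‖₊, hsa.spectralRadius_eq_nnnorm, fun x => ?_⟩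
  set z : EuclideanSpace ℂ ι := WithLp.toLp 2 (fun i => (x i : ℂ)) with hz
  set T := Matrix.toEuclideanCLM (n := ι) (𝕜 := ℂ) (S.map Complex.ofReal) with hT
  have h1 : inner ℂ z (T z) = ((x ⬝ᵥ S.mulVec x : ℝ) : ℂ) := by
    simp [hz, hT, PiLp.inner_apply, dotProduct, Matrix.mulVec, mul_comm]
  have h2 : ‖z‖ * ‖z‖ = x ⬝ᵥ x := by
    rw [← sq, EuclideanSpace.norm_sq_eq]
    simp [hz, dotProduct, sq]
  have h3 : ‖inner ℂ z (T z)‖ ≤ ‖z‖ * (‖T‖ * ‖z‖) :=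
    (norm_inner_le_norm _ _).trans (by gcongr; exact T.le_opNorm z)
  rw [h1, Complex.norm_real, Real.norm_eq_abs] at h3
  rw [← h2, coe_nnnorm, ← Matrix.l2_opNorm_toEuclideanCLM]
  linarith

/-- The iteration matrix of a splitting with positive diagonal first component is similar to a
symmetric matrix. -/
theorem spectrum_diagonal_inv_mul {B : Matrix ι ι ℝ} {d : ι → ℝ} (hd : ∀ i, 0 < d i) :
    spectrum ℂ (((Matrix.diagonal d)⁻¹ * B).map Complex.ofReal) =
      spectrum ℂ ((Matrix.diagonal (fun i => (√(d i))⁻¹) * B *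
        Matrix.diagonal (fun i => (√(d i))⁻¹)).map Complex.ofReal) := by
  have hs : ∀ i, √(d i) ≠ 0 := fun i => (Real.sqrt_pos.2 (hd i)).ne'
  -- With `D = diagonal d` and `u = D^{1/2}`, `u (D⁻¹B) u⁻¹ = D^{-1/2} B D^{-1/2}`.
  let u : (Matrix ι ι ℂ)ˣ :=
    { val := Matrix.diagonal fun i => ((√(d i) : ℝ) : ℂ)
      inv := Matrix.diagonal fun i => ((√(d i) : ℝ) : ℂ)⁻¹
      val_inv := by simp [Matrix.diagonal_mul_diagonal, hs]
      inv_val := by simp [Matrix.diagonal_mul_diagonal, hs] }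
  rw [← spectrum.units_conjugate (u := u)]
  congr 1
  have hdi : (Matrix.diagonal d)⁻¹ = Matrix.diagonal fun i => (d i)⁻¹ := by
    refine Matrix.inv_eq_left_inv ?_
    simp [Matrix.diagonal_mul_diagonal, (hd _).ne']
  ext i j
  rw [hdi]
  simp only [u, Matrix.map_apply, Matrix.diagonal_mul, Matrix.mul_diagonal, Units.inv_mk]
  have h : (d i)⁻¹ = (√(d i))⁻¹ * (√(d i))⁻¹ := by
    rw [← mul_inv, Real.mul_self_sqrt (hd i).le]
  rw [h]
  have := hs i
  push_cast
  field_simp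

/-- Evaluating the form of the symmetric matrix `D^{-1/2} B D^{-1/2}` at `D^{1/2} x` produces the
weighted bound. -/
theorem exists_splittingRadius_eq_and_abs_dotProduct_le {B : Matrix ι ι ℝ} (hB : B.IsSymm)
    {d : ι → ℝ} (hd : ∀ i, 0 < d i) :
    ∃ r : NNReal, splittingRadius (Matrix.diagonal d) B = r ∧
      ∀ x : ι → ℝ, |x ⬝ᵥ B.mulVec x| ≤ r * ∑ i, d i * x i ^ 2 := by
  have hs : ∀ i, √(d i) ≠ 0 := fun i => (Real.sqrt_pos.2 (hd i)).ne'
  set S := Matrix.diagonal (fun i => (√(d i))⁻¹) * B * Matrix.diagonal (fun i => (√(d i))⁻¹)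
    with hSdef
  have hS : S.IsSymm := by
    rw [Matrix.IsSymm, hSdef]
    simp [Matrix.transpose_mul, hB.eq, Matrix.mul_assoc]
  obtain ⟨r, hr, hx⟩ := exists_spectralRadius_eq_and_abs_dotProduct_le hS
  refine ⟨r, ?_, fun x => ?_⟩
  · rw [splittingRadius, spectralRadius, spectrum_diagonal_inv_mul hd]
    exact hr
  · have h := hx (fun i => √(d i) * x i)
    have e1 : (fun i => √(d i) * x i) ⬝ᵥ S.mulVec (fun i => √(d i) * x i) =
        x ⬝ᵥ B.mulVec x := by
      simp only [dotProduct, Matrix.mulVec, hSdef, Matrix.diagonal_mul, Matrix.mul_diagonal,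
        Finset.mul_sum]
      refine Finset.sum_congr rfl fun i _ => Finset.sum_congr rfl fun j _ => ?_
      have := hs i
      have := hs j
      field_simp
    have e2 : (fun i => √(d i) * x i) ⬝ᵥ (fun i => √(d i) * x i) = ∑ i, d i * x i ^ 2 := by
      refine Finset.sum_congr rfl fun i _ => ?_
      rw [mul_mul_mul_comm, Real.mul_self_sqrt (hd i).le, sq]
    rwa [e1, e2] at h

/-- An eigenvector `v = a + ib` satisfies `Bv = μDv`. Pairing with the conjugate of `v` gives
`μ(aᵀDa + bᵀDb) = aᵀBa + bᵀBb`, the cross terms cancelling by symmetry; the real bound then applies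
to `a` and `b` separately. -/
theorem splittingRadius_le_of_abs_dotProduct_le {B : Matrix ι ι ℝ} (hB : B.IsSymm)
    {d : ι → ℝ} (hd : ∀ i, 0 < d i) {r : NNReal}
    (h : ∀ x : ι → ℝ, |x ⬝ᵥ B.mulVec x| ≤ r * ∑ i, d i * x i ^ 2) :
    splittingRadius (Matrix.diagonal d) B ≤ r := by
  refine iSup₂_le fun μ hμ => ?_
  rw [← Matrix.spectrum_toLin', ← Module.End.hasEigenvalue_iff_mem_spectrum] at hμ
  obtain ⟨v, hv⟩ := hμ.exists_hasEigenvector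
  have hv0 := hv.2
  have hev := hv.apply_eq_smul
  rw [Matrix.toLin'_apply] at hev
  have hdi : (Matrix.diagonal d)⁻¹ = Matrix.diagonal fun i => (d i)⁻¹ := by
    refine Matrix.inv_eq_left_inv ?_
    simp [Matrix.diagonal_mul_diagonal, (hd _).ne']
  have hcoord : ∀ i, ∑ j, (B i j : ℂ) * v j = μ * (d i * v i) := fun i => by
    have hi := congrFun hev i
    have hdc : (d i : ℂ) ≠ 0 := by exact_mod_cast (hd i).ne'
    simp only [hdi, Matrix.mulVec, dotProduct, Matrix.map_apply, Matrix.diagonal_mul,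
      Complex.ofReal_mul, Complex.ofReal_inv, mul_assoc, ← Finset.mul_sum, Pi.smul_apply,
      smul_eq_mul] at hi
    rw [inv_mul_eq_iff_eq_mul₀ hdc] at hi
    rw [hi]; ring
  set a : ι → ℝ := fun i => (v i).re with ha
  set b : ι → ℝ := fun i => (v i).im with hb
  have hsum : ∑ i, (starRingEnd ℂ) (v i) * ∑ j, (B i j : ℂ) * v j =
      μ * ((∑ i, d i * a i ^ 2 + ∑ i, d i * b i ^ 2 : ℝ) : ℂ) := by
    rw [← Finset.sum_add_distrib]
    push_cast
    rw [Finset.mul_sum]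
    refine Finset.sum_congr rfl fun i _ => ?_
    rw [hcoord]
    have : (starRingEnd ℂ) (v i) * v i = (a i : ℂ) ^ 2 + (b i : ℂ) ^ 2 := by
      rw [← Complex.normSq_eq_conj_mul_self, Complex.normSq_apply]
      push_cast; ring
    linear_combination μ * d i * this
  have hreal : ∑ i, (starRingEnd ℂ) (v i) * ∑ j, (B i j : ℂ) * v j =
      ((a ⬝ᵥ B.mulVec a + b ⬝ᵥ B.mulVec b : ℝ) : ℂ) := by
    have hcross : ∑ i, ∑ j, a i * (B i j * b j) = ∑ i, ∑ j, b i * (B i j * a j) := by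
      rw [Finset.sum_comm]
      refine Finset.sum_congr rfl fun i _ => Finset.sum_congr rfl fun j _ => ?_
      rw [hB.apply i j]; ring
    apply Complex.ext
    · simp [dotProduct, Matrix.mulVec, ha, hb, Finset.sum_add_distrib]
    · simp only [Complex.im_sum, Complex.mul_im, Complex.conj_re, Complex.conj_im,
        Complex.mul_re, Complex.ofReal_re, Complex.ofReal_im, zero_mul, sub_zero,
        add_zero, Finset.mul_sum, Finset.sum_add_distrib, neg_mul, Finset.sum_neg_distrib]
      simp only [ha, hb] at hcross
      rw [hcross]; ring
  have hpos : 0 < ∑ i, d i * a i ^ 2 + ∑ i, d i * b i ^ 2 := by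
    rw [← Finset.sum_add_distrib]
    obtain ⟨i, hi⟩ := Function.ne_iff.1 hv0
    refine Finset.sum_pos' (fun j _ => ?_) ⟨i, Finset.mem_univ i, ?_⟩
    · have := hd j
      positivity
    · have h1 : 0 < Complex.normSq (v i) := Complex.normSq_pos.2 hi
      rw [Complex.normSq_apply] at h1
      have := mul_pos (hd i) h1
      simp only [ha, hb]
      nlinarith
  have hnorm := congrArg norm (hsum.symm.trans hreal)
  rw [norm_mul, Complex.norm_real, Complex.norm_real, Real.norm_of_nonneg hpos.le,
    Real.norm_eq_abs] at hnorm
  have hle := (abs_add_le (a ⬝ᵥ B.mulVec a) (b ⬝ᵥ B.mulVec b)).trans (add_le_add (h a) (h b))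
  rw [← hnorm, ← mul_add] at hle
  have : ‖μ‖ ≤ r := le_of_mul_le_mul_right hle hpos
  exact_mod_cast this

/-! ### The splitting with parameter `α` and monotonicity of its radius -/

theorem first_eq_diagonal (P : Matrix ι ι ℝ) (α : ℝ) :
    first P α = Matrix.diagonal fun i => P i i + α * ∑ j, |offDiagPart P i j| := by
  ext i j
  by_cases h : i = j
  · subst h; simp [first, diagPart, absRowSum]
  · simp [first, diagPart, absRowSum, h]

theorem first_diag_pos {P : Matrix ι ι ℝ} (hP : ∀ i, 0 < P i i) {α : ℝ} (hα : 0 ≤ α) (i : ι) :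
    0 < P i i + α * ∑ j, |offDiagPart P i j| :=
  add_pos_of_pos_of_nonneg (hP i) (by positivity)

theorem isSplitting_first_second {P : Matrix ι ι ℝ} (hP : ∀ i, 0 < P i i) {α : ℝ}
    (hα : 0 ≤ α) : IsSplitting P (first P α) (second P α) := by
  refine ⟨?_, ?_⟩
  · rw [first_eq_diagonal, Matrix.isUnit_diagonal, Pi.isUnit_iff]
    exact fun i => (first_diag_pos hP hα i).ne'.isUnit
  · rw [first, second, offDiagPart]
    abel

theorem second_isSymm {P : Matrix ι ι ℝ} (hP : P.IsSymm) (α : ℝ) : (second P α).IsSymm := by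
  simp [Matrix.IsSymm, second, absRowSum, (offDiagPart_isSymm hP).eq]

theorem dotProduct_second_mulVec (P : Matrix ι ι ℝ) (α : ℝ) (x : ι → ℝ) :
    x ⬝ᵥ (second P α).mulVec x = α * ∑ i, (∑ j, |offDiagPart P i j|) * x i ^ 2 -
      x ⬝ᵥ (offDiagPart P).mulVec x := by
  simp only [second, Matrix.sub_mulVec, dotProduct_sub, Matrix.smul_mulVec, dotProduct_smul,
    absRowSum, smul_eq_mul]
  congr 2
  simp only [dotProduct, Matrix.mulVec_diagonal]
  exact Finset.sum_congr rfl fun i _ => by ring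

theorem dotProduct_mulVec_eq_diag_add (P : Matrix ι ι ℝ) (x : ι → ℝ) :
    x ⬝ᵥ P.mulVec x = ∑ i, P i i * x i ^ 2 + x ⬝ᵥ (offDiagPart P).mulVec x := by
  simp only [offDiagPart, Matrix.sub_mulVec, dotProduct_sub, diagPart]
  have : x ⬝ᵥ (Matrix.diagonal P.diag).mulVec x = ∑ i, P i i * x i ^ 2 := by
    simp only [dotProduct, Matrix.mulVec_diagonal, Matrix.diag_apply]
    exact Finset.sum_congr rfl fun i _ => by ring
  rw [this]; ring

/-- For a positive semidefinite matrix with positive diagonal, the spectral radius of the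
splitting is monotone in its parameter. -/
theorem splittingRadius_mono {P : Matrix ι ι ℝ} (hP : P.PosSemidef) (hdiag : ∀ i, 0 < P i i)
    {α₁ α₂ : ℝ} (hα₁ : 1 / 2 ≤ α₁) (hα : α₁ ≤ α₂) :
    splittingRadius (first P α₁) (second P α₁) ≤ splittingRadius (first P α₂) (second P α₂) := by
  have hsymm : P.IsSymm := by
    have := hP.isHermitian.eq
    rwa [Matrix.conjTranspose_eq_transpose_of_trivial] at this
  have h0 : 0 ≤ α₁ := by linarith
  obtain ⟨r, hr, hq⟩ := exists_splittingRadius_eq_and_abs_dotProduct_le (second_isSymm hsymm α₂)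
    (first_diag_pos hdiag (h0.trans hα))
  rw [first_eq_diagonal P α₂, hr, first_eq_diagonal P α₁]
  have hr0 : (0 : ℝ) ≤ r := r.2
  set D : ι → ℝ := fun i => ∑ j, |offDiagPart P i j| with hD
  have hD0 : ∀ i, 0 ≤ D i := fun i => Finset.sum_nonneg fun j _ => abs_nonneg _
  have hcoord : ∀ i, α₁ * D i ≤ r * (P i i + α₁ * D i) := fun i => by
    -- On the `i`-th unit vector the form of `Ω` vanishes, since `Ω` has zero diagonal.
    have h := (le_abs_self _).trans (hq (Pi.single i 1))
    rw [dotProduct_second_mulVec] at h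
    have hz : offDiagPart P i i = 0 := by simp [offDiagPart, diagPart]
    simp [Pi.single_apply, hz] at h
    change α₂ * D i ≤ r * (P i i + α₂ * D i) at h
    rcases le_total (1 : ℝ) r with h1 | h1
    · have := hdiag i
      have := mul_nonneg h0 (hD0 i)
      nlinarith
    · nlinarith [mul_nonneg (mul_nonneg (sub_nonneg.2 hα) (hD0 i)) (sub_nonneg.2 h1)]
  refine splittingRadius_le_of_abs_dotProduct_le (second_isSymm hsymm α₁)
    (first_diag_pos hdiag h0) fun x => ?_
  set Q := ∑ i, D i * x i ^ 2 with hQ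
  set E := ∑ i, P i i * x i ^ 2 with hE
  have hsplit : ∀ α : ℝ, ∑ i, (P i i + α * D i) * x i ^ 2 = E + α * Q := fun α => by
    rw [hQ, hE, Finset.mul_sum, ← Finset.sum_add_distrib]
    exact Finset.sum_congr rfl fun i _ => by ring
  have hQ0 : 0 ≤ Q := Finset.sum_nonneg fun i _ => mul_nonneg (hD0 i) (sq_nonneg _)
  have hE0 : 0 ≤ E := Finset.sum_nonneg fun i _ => mul_nonneg (hdiag i).le (sq_nonneg _)
  have hPx : 0 ≤ E + x ⬝ᵥ (offDiagPart P).mulVec x := by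
    rw [← dotProduct_mulVec_eq_diag_add]
    simpa using hP.dotProduct_mulVec_nonneg x
  have hΩ := dotProduct_mulVec_le_sum_abs (offDiagPart_isSymm hsymm) x
  have hq' := (le_abs_self _).trans (hq x)
  rw [dotProduct_second_mulVec] at hq' ⊢
  change _ ≤ r * ∑ i, (P i i + α₁ * D i) * x i ^ 2
  change α₂ * Q - _ ≤ r * ∑ i, (P i i + α₂ * D i) * x i ^ 2 at hq'
  change _ ≤ Q at hΩ
  change |α₁ * Q - _| ≤ _
  rw [hsplit] at hq' ⊢
  set W := x ⬝ᵥ (offDiagPart P).mulVec x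
  have hαQ : α₁ * Q ≤ r * (E + α₁ * Q) := by
    rw [← hsplit, hQ, Finset.mul_sum, Finset.mul_sum]
    refine Finset.sum_le_sum fun i _ => ?_
    have := mul_le_mul_of_nonneg_right (hcoord i) (sq_nonneg (x i))
    linarith
  rw [abs_le]
  constructor
  -- Here `W - α₁Q ≤ (1 - α₁)Q ≤ α₁Q`, which uses `α₁ ≥ 1/2`, and `hαQ` concludes.
  · nlinarith
  · rcases le_total (1 : ℝ) r with h1 | h1
    -- Semidefiniteness gives `α₁Q - W ≤ E + α₁Q`.
    · have := mul_nonneg h0 hQ0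
      nlinarith
    -- Subtract `(α₂ - α₁)Q ≥ r(α₂ - α₁)Q` from the bound for `α₂`.
    · nlinarith [mul_nonneg (mul_nonneg (sub_nonneg.2 hα) hQ0) (sub_nonneg.2 h1)]

end MatrixSplitting

/-! ### Hessian of the barrier objective -/

/-- The second derivative of a concave function on the positive half-line is nonpositive. -/
theorem ConcaveOn.deriv_deriv_nonpos_of_pos {g : ℝ → ℝ} (hc : ConcaveOn ℝ (Set.Ioi 0) g)
    (hd : DifferentiableOn ℝ g (Set.Ioi 0)) {x : ℝ} (hx : 0 < x) : deriv (deriv g) x ≤ 0 := by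
  have hanti := hc.antitoneOn_deriv fun z hz => hd.differentiableAt (Ioi_mem_nhds hz)
  rw [← derivWithin_of_isOpen isOpen_Ioi hx]
  exact hanti.derivWithin_nonpos

theorem hasDerivAt_add_mul_const (a b x : ℝ) : HasDerivAt (fun s : ℝ => a + s * b) b x := by
  simpa using ((hasDerivAt_id x).mul_const b).const_add a

theorem HasDerivAt.comp_add_mul_const {g : ℝ → ℝ} {g' a : ℝ} (h : HasDerivAt g g' a) (b : ℝ) :
    HasDerivAt (fun s : ℝ => g (a + s * b)) (g' * b) 0 :=
  HasDerivAt.comp (h₂ := g) 0 (by simpa using h) (hasDerivAt_add_mul_const a b 0)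

theorem ContDiffOn.hasDerivAt_deriv_of_pos {g : ℝ → ℝ} (hg : ContDiffOn ℝ 2 g (Set.Ioi 0))
    {x : ℝ} (hx : 0 < x) : HasDerivAt (deriv g) (deriv (deriv g) x) x := by
  have h1 : ContDiffOn ℝ 1 (deriv g) (Set.Ioi 0) :=
    hg.deriv_of_isOpen isOpen_Ioi (by norm_num)
  exact ((h1.differentiableOn (by norm_num)).differentiableAt (Ioi_mem_nhds hx)).hasDerivAt

namespace FlowNetwork

variable {V L S : Type*} (N : FlowNetwork V L S)

section Hessian

variable [Fintype S]

theorem slack_add_smul (y w : PrimalIdx L S → ℝ) (l : L) (s : ℝ) :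
    N.slack (y + s • w) l = N.slack y l + s * -∑ f, w (Sum.inr (l, f)) := by
  simp [slack, Finset.sum_add_distrib, ← Finset.mul_sum]
  ring

variable {U : S → ℝ → ℝ} {t : ℝ} {y : PrimalIdx L S → ℝ}

/-- The diagonal part of the Hessian of the barrier objective that does not come from the
capacity constraints. -/
noncomputable def hessianDiag (U : S → ℝ → ℝ) (t : ℝ) (y : PrimalIdx L S → ℝ) :
    PrimalIdx L S → ℝ
  | Sum.inl f => -t * deriv (deriv (U f)) (y (Sum.inl f)) + (y (Sum.inl f) ^ 2)⁻¹
  | Sum.inr p => (y (Sum.inr p) ^ 2)⁻¹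

theorem hessianDiag_pos (hc : ∀ f, ConcaveOn ℝ (Set.Ioi 0) (U f))
    (hU : ∀ f, DifferentiableOn ℝ (U f) (Set.Ioi 0)) (ht : 0 ≤ t) (hy : N.IsInterior y)
    (i : PrimalIdx L S) : 0 < hessianDiag U t y i := by
  rcases i with f | ⟨l, f⟩
  · have h1 := (hc f).deriv_deriv_nonpos_of_pos (hU f) (hy.1 f)
    have h2 : 0 < (y (Sum.inl f) ^ 2)⁻¹ := inv_pos.2 (pow_pos (hy.1 f) 2)
    simp only [hessianDiag]
    nlinarith
  · exact inv_pos.2 (pow_pos (hy.2.1 l f) 2)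

variable [Fintype L]

/-- The directional derivative of the barrier objective. -/
noncomputable def barrierDeriv (U : S → ℝ → ℝ) (t : ℝ) (w y : PrimalIdx L S → ℝ) : ℝ :=
  -t * ∑ f, deriv (U f) (y (Sum.inl f)) * w (Sum.inl f)
    - ∑ l, (N.slack y l)⁻¹ * -∑ f, w (Sum.inr (l, f))
    - ∑ f, (y (Sum.inl f))⁻¹ * w (Sum.inl f)
    - ∑ l, ∑ f, (y (Sum.inr (l, f)))⁻¹ * w (Sum.inr (l, f))

theorem hasLineDerivAt_barrierObjective
    (hU : ∀ f, DifferentiableOn ℝ (U f) (Set.Ioi 0)) (hy : N.IsInterior y)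
    (w : PrimalIdx L S → ℝ) :
    HasLineDerivAt ℝ (N.barrierObjective U t) (N.barrierDeriv U t w y) y w := by
  obtain ⟨hs, hx, hsl⟩ := hy
  simp only [HasLineDerivAt, barrierObjective, barrierDeriv, slack_add_smul, Pi.add_apply,
    Pi.smul_apply, smul_eq_mul]
  refine (((HasDerivAt.const_mul _ (.fun_sum fun f _ => ?_)).sub (.fun_sum fun l _ => ?_)).sub
    (.fun_sum fun f _ => ?_)).sub (.fun_sum fun l _ => .fun_sum fun f _ => ?_)
  · exact ((hU f).differentiableAt (Ioi_mem_nhds (hs f))).hasDerivAt.comp_add_mul_const _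
  · exact (Real.hasDerivAt_log (hsl l).ne').comp_add_mul_const _
  · exact (Real.hasDerivAt_log (hs f).ne').comp_add_mul_const _
  · exact (Real.hasDerivAt_log (hx l f).ne').comp_add_mul_const _

theorem hasLineDerivAt_barrierDeriv (hU : ∀ f, ContDiffOn ℝ 2 (U f) (Set.Ioi 0))
    (hy : N.IsInterior y) (w u : PrimalIdx L S → ℝ) :
    HasLineDerivAt ℝ (N.barrierDeriv U t w)
      (-t * ∑ f, deriv (deriv (U f)) (y (Sum.inl f)) * u (Sum.inl f) * w (Sum.inl f)
        - ∑ l, -(N.slack y l ^ 2)⁻¹ * (-∑ f, u (Sum.inr (l, f))) * -∑ f, w (Sum.inr (l, f))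
        - ∑ f, -(y (Sum.inl f) ^ 2)⁻¹ * u (Sum.inl f) * w (Sum.inl f)
        - ∑ l, ∑ f, -(y (Sum.inr (l, f)) ^ 2)⁻¹ * u (Sum.inr (l, f)) * w (Sum.inr (l, f)))
      y u := by
  obtain ⟨hs, hx, hsl⟩ := hy
  simp only [HasLineDerivAt, barrierDeriv, slack_add_smul, Pi.add_apply,
    Pi.smul_apply, smul_eq_mul]
  refine (((HasDerivAt.const_mul _ (.fun_sum fun f _ => .mul_const ?_ _)).sub
    (.fun_sum fun l _ => .mul_const ?_ _)).sub (.fun_sum fun f _ => .mul_const ?_ _)).sub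
    (.fun_sum fun l _ => .fun_sum fun f _ => .mul_const ?_ _)
  · exact ((hU f).hasDerivAt_deriv_of_pos (hs f)).comp_add_mul_const _
  · exact (hasDerivAt_inv (hsl l).ne').comp_add_mul_const _
  · exact (hasDerivAt_inv (hs f).ne').comp_add_mul_const _
  · exact (hasDerivAt_inv (hx l f).ne').comp_add_mul_const _

open Filter Topology in
theorem eventually_isInterior (hy : N.IsInterior y) : ∀ᶠ z in 𝓝 y, N.IsInterior z := by
  obtain ⟨hs, hx, hsl⟩ := hy
  refine (eventually_all.2 fun f => ?_).and ((eventually_all.2 fun l => eventually_all.2 fun f =>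
    ?_).and (eventually_all.2 fun l => ?_))
  · exact (continuous_apply (Sum.inl f)).continuousAt.eventually (lt_mem_nhds (hs f))
  · exact (continuous_apply (Sum.inr (l, f))).continuousAt.eventually (lt_mem_nhds (hx l f))
  · have : Continuous fun z => N.slack z l := by unfold slack; fun_prop
    exact this.continuousAt.eventually (lt_mem_nhds (hsl l))

variable [DecidableEq L] [DecidableEq S]

/-- The matrix that maps a primal vector to the total flows on the links. -/
def linkLoad (L S : Type*) [Fintype S] [DecidableEq L] [DecidableEq S] :
    Matrix L (PrimalIdx L S) ℝ :=
  Matrix.of fun l i => ∑ f, (Pi.single i 1 : PrimalIdx L S → ℝ) (Sum.inr (l, f))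

/-- The utilities and the logarithms of single coordinates are separable and give the diagonal; the
capacity barriers see `y` only through the link loads and give the congruence term. -/
theorem hessian_eq (hU : ∀ f, ContDiffOn ℝ 2 (U f) (Set.Ioi 0)) (hy : N.IsInterior y) :
    N.hessian U t y = Matrix.diagonal (hessianDiag U t y) +
      (linkLoad L S).transpose * Matrix.diagonal (fun l => (N.slack y l ^ 2)⁻¹) *
        linkLoad L S := by
  have hU' : ∀ f, DifferentiableOn ℝ (U f) (Set.Ioi 0) := fun f =>
    (hU f).differentiableOn (by norm_num)
  ext i j
  -- Differentiating a second time requires the first derivative on a neighbourhood of `y`, hence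
  -- the openness of the interior.
  have hev : (fun z => lineDeriv ℝ (N.barrierObjective U t) z (Pi.single j 1)) =ᶠ[nhds y]
      N.barrierDeriv U t (Pi.single j 1) := by
    filter_upwards [N.eventually_isInterior hy] with z hz
    exact (N.hasLineDerivAt_barrierObjective hU' hz _).lineDeriv
  rw [hessian, hessianMatrix, Matrix.of_apply, hev.lineDeriv_eq,
    (N.hasLineDerivAt_barrierDeriv hU hy _ _).lineDeriv, Matrix.add_apply, Matrix.mul_apply]
  simp only [Matrix.mul_diagonal, Matrix.transpose_apply]
  -- As a sum over all coordinates, the diagonal entry splits into rate and flow blocks like the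
  -- computed derivative.
  have hdiag : Matrix.diagonal (hessianDiag U t y) i j =
      ∑ k, hessianDiag U t y k * (Pi.single i 1 : PrimalIdx L S → ℝ) k *
        (Pi.single j 1 : PrimalIdx L S → ℝ) k := by
    by_cases h : i = j
    · subst h; simp [Pi.single_apply]
    · simp [Pi.single_apply, h, Ne.symm h]
  rw [hdiag, Fintype.sum_sum_type, Fintype.sum_prod_type]
  simp only [hessianDiag, linkLoad, Matrix.of_apply]
  have hrate : ∀ a b c d : S → ℝ, ∑ f, (-t * a f + b f) * c f * d f =
      -t * ∑ f, a f * c f * d f + ∑ f, b f * c f * d f := fun a b c d => by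
    rw [Finset.mul_sum, ← Finset.sum_add_distrib]
    exact Finset.sum_congr rfl fun f _ => by ring
  have hload : ∀ a b c : L → ℝ, ∑ l, a l * b l * c l = -∑ l, -b l * -a l * -c l :=
    fun a b c => by
      rw [← Finset.sum_neg_distrib]
      exact Finset.sum_congr rfl fun l _ => by ring
  rw [hrate, hload]
  simp only [neg_mul, Finset.sum_neg_distrib, sub_neg_eq_add]
  ring_nf

theorem hessian_posDef (hc : ∀ f, ConcaveOn ℝ (Set.Ioi 0) (U f))
    (hU : ∀ f, ContDiffOn ℝ 2 (U f) (Set.Ioi 0)) (ht : 0 ≤ t) (hy : N.IsInterior y) :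
    (N.hessian U t y).PosDef := by
  rw [N.hessian_eq hU hy]
  refine Matrix.PosDef.add_posSemidef (Matrix.PosDef.diagonal (N.hessianDiag_pos hc (fun f =>
    (hU f).differentiableOn (by norm_num)) ht hy)) ?_
  have h : (Matrix.diagonal fun l => (N.slack y l ^ 2)⁻¹).PosSemidef :=
    Matrix.PosSemidef.diagonal fun l => by positivity
  simpa [Matrix.conjTranspose_eq_transpose_of_trivial] using
    h.conjTranspose_mul_mul_same (linkLoad L S)

end Hessian

/-! ### Constraint matrix and dual matrix -/

variable [DecidableEq V]

/-- Every node of a connected network that differs from some other node has an incident link. -/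
theorem exists_incidence_ne_zero {n m : V} (h : n ≠ m) : ∃ l, N.incidence n l ≠ 0 := by
  have : Nontrivial V := ⟨n, m, h⟩
  obtain ⟨k, hk⟩ := N.connected.preconnected.exists_adj_of_nontrivial n
  rw [SimpleGraph.fromRel_adj] at hk
  obtain ⟨-, ⟨l, hl, -⟩ | ⟨l, -, hl⟩⟩ := hk
  · exact ⟨l, by simp [incidence, hl]⟩
  · refine ⟨l, ?_⟩
    have := N.tx_ne_rx l
    rw [hl] at this
    simp [incidence, hl, this.symm]

variable [DecidableEq S]

/-- The node of a dual index differs from the destination, so it has an incident link, whose column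
for the same session is nonzero in this row. -/
theorem constraintMatrix_row_ne_zero (r : N.DualIdx) : N.constraintMatrix r ≠ 0 := by
  obtain ⟨l, hl⟩ := N.exists_incidence_ne_zero r.2
  intro h
  have := congrFun h (Sum.inr (l, r.1.2))
  simp [constraintMatrix, hl] at this

variable [Fintype L] [Fintype S] [DecidableEq L] {U : S → ℝ → ℝ} {t : ℝ}
  {y : PrimalIdx L S → ℝ}

/-- The diagonal entry is the form of `H⁻¹` at a nonzero row of `M`. -/
theorem dualMatrix_diag_pos (hH : (N.hessian U t y).PosDef) (r : N.DualIdx) :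
    0 < N.dualMatrix U t y r r := by
  have h := hH.inv.dotProduct_mulVec_pos (N.constraintMatrix_row_ne_zero r)
  rw [dualMatrix, Matrix.mul_assoc]
  simpa [Matrix.mul_apply, dotProduct, Matrix.mulVec] using h

theorem dualMatrix_posSemidef [Fintype V] (hH : (N.hessian U t y).PosDef) :
    (N.dualMatrix U t y).PosSemidef := by
  simpa [dualMatrix, Matrix.conjTranspose_eq_transpose_of_trivial] using
    hH.inv.posSemidef.mul_mul_conjTranspose_same N.constraintMatrix

end FlowNetwork

theorem proposition1 {V L S : Type*} [Fintype V] [Fintype L] [Fintype S]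
    [DecidableEq V] [DecidableEq L] [DecidableEq S]
    (N : FlowNetwork V L S) (U : S → ℝ → ℝ)
    (hU_concave : ∀ f, StrictConcaveOn ℝ (Set.Ioi 0) (U f))
    (hU_mono : ∀ f, MonotoneOn (U f) (Set.Ioi 0))
    (hU_smooth : ∀ f, ContDiffOn ℝ 2 (U f) (Set.Ioi 0))
    (t : ℝ) (ht : 0 < t) (y : PrimalIdx L S → ℝ) (hy : N.IsInterior y)
    (α₁ α₂ : ℝ) (hα₁ : 1 / 2 < α₁) (hα : α₁ ≤ α₂) :
    IsUnit (N.hessian U t y) ∧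
    MatrixSplitting.IsSplitting (N.dualMatrix U t y)
      (MatrixSplitting.first (N.dualMatrix U t y) α₁)
      (MatrixSplitting.second (N.dualMatrix U t y) α₁) ∧
    MatrixSplitting.IsSplitting (N.dualMatrix U t y)
      (MatrixSplitting.first (N.dualMatrix U t y) α₂)
      (MatrixSplitting.second (N.dualMatrix U t y) α₂) ∧
    MatrixSplitting.splittingRadius
        (MatrixSplitting.first (N.dualMatrix U t y) α₁)
        (MatrixSplitting.second (N.dualMatrix U t y) α₁) ≤
      MatrixSplitting.splittingRadius
        (MatrixSplitting.first (N.dualMatrix U t y) α₂)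
        (MatrixSplitting.second (N.dualMatrix U t y) α₂) := by

  have hH := N.hessian_posDef (fun f => (hU_concave f).concaveOn) hU_smooth ht.le hy
  have hP := N.dualMatrix_posSemidef hH
  have hdiag := N.dualMatrix_diag_pos hH
  exact ⟨hH.isUnit, MatrixSplitting.isSplitting_first_second hdiag (by linarith),
    MatrixSplitting.isSplitting_first_second hdiag (by linarith),
    MatrixSplitting.splittingRadius_mono hP hdiag hα₁.le hα⟩
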